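/- All sets and families are finite. A family is a set of sets of natural numbers, and $\bigcup F$ denotes the union of all members of the family $F$. The closure $\langle F\rangle$ of $F$ is the smallest family that contains $F$ and is closed under unions of two of its members (equivalently, the set of all unions of nonempty subfamilies of $F$). Families $F$ and $F'$ are isomorphic if there is a bijection $f:\bigcup F\to\bigcup F'$ with $\{f(A) : A\in F\}=F'$. Let $\mathcal F$ and $\mathcal N$ be collections of families. A family $F$ is covered by $\mathcal F$ and $\mathcal N$ if at least one of the following holds: (i) there are $G\in\mathcal F$ and a family $G'$ isomorphic to $G$ with $G'\subseteq\langle F\rangle$ ($F$ is FC-covered by $\mathcal F$); (ii) there are $N\in\mathcal N$ and a family $N'$ isomorphic to $N$ with $\langle F\rangle\subseteq\langle N'\rangle\cup\{\emptyset\}$ ($F$ is nonFC-covered by $\mathcal N$). Theorem. Let $\mathcal F_c^6$ and $\mathcal N_c^6$ be the collections of 197 and of 115 families listed below. Every family $F$ with $\bigcup F\subseteq\{0,1,2,3,4,5\}$ is covered by $\mathcal F_c^6$ and $\mathcal N_c^6$. In the lists, a set is written as the string of its elements, the sets of one family are separated by blanks, and the families are separated by semicolons; for example, 012 034 stands for $\{\{0,1,2\},\{0,3,4\}\}$.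 The collection $\mathcal F_c^6$: 0123 0124 0134 0234 01235 12345; 0123 0124 0125 0134 01345 02345 12345; 0123 0124 0134 0234 1234; 0123 0124 0134 0234 1235; 0123 0124 0125 0134 0235 12345; 0123 0124 0125 0134 0345 12345; 0123 0124 0125 0345 1345 02345; 0123 0124 0134 0235 0245 12345; 0123 0124 0134 0235 1235 01245; 0123 0124 0134 0235 1245 02345; 0123 0124 0134 0235 2345 01245; 0123 0124 0134 0235 2345 12345; 0123 0124 0135 0145 2345 02345; 0123 0124 0135 0245 0345 12345; 0123 0124 0135 0245 1345 02345; 0123 0124 0125 0134 2345 01345 02345; 0123 0124 0125 0134 2345 02345 12345; 0123 0124 0125 0134 0135 0234; 0123 0124 0125 0134 0135 2345; 0123 0124 0125 0134 0234 0345; 0123 0124 0125 0134 0235 1245; 0123 0124 0125 0134 0135 0145 02345; 0123 0124 0125 0134 0135 0245 02345; 012 0134 0135 02345 12345; 012 0134 0234 01235 12345; 012 0134 0235 01245 12345; 012 0134 0235 01345 12345; 012 0134 0345 01235 01245 12345; 012 0134 2345 01235 01245 02345 12345; 012 0123 0134 01235 01245 01345 02345 12345; 012 0345 1345 01234 01235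 01245 02345 12345; 012 0134 0234 1234; 012 0134 0234 1235; 012 0134 0235 1245; 012 0134 0235 1345; 012 0123 0134 0234 12345; 012 0123 0134 0235 12345; 012 0123 0134 0245 12345; 012 0123 0145 0245 12345; 012 0134 0135 0145 02345; 012 0134 0135 0234 01245; 012 0134 0135 0245 02345; 012 0134 0135 0345 12345; 012 0134 0135 2345 01245; 012 0134 0135 2345 02345; 012 0134 0234 0345 12345; 012 0134 0234 1345 01235; 012 0134 0234 1345 12345; 012 0123 0134 0345 01245 12345; 012 0134 0345 1345 01235 01245; 012 0134 0345 1345 01235 02345; 012 0134 0345 2345 01235 01245; 012 0134 0345 2345 01235 12345; 012 0123 0134 0345 01235 02345 12345; 012 0123 0134 2345 01245 02345 12345; 012 0123 0145 0345 01234 02345 12345; 012 0123 0124 0134 01235 01245 02345 12345; 012 0123 0124 0134 01235 01345 02345 12345; 012 0123 0134 2345 01235 01345 02345 12345; 012 0123 0145 2345 01234 01345 02345 12345; 012 0123 0134 0135 0234; 012 0123 0134 0145 0234; 012 0123 0134 0234 1345; 012 0123 0145 0245 1345; 012 0134 0135 0145 0345; 012 0134 0135 0234 0235; 012 0134 0135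 0234 0345; 012 0134 0135 0345 1345; 012 0134 0234 0345 1345; 012 0123 0124 0134 0345 12345; 012 0123 0134 0145 0245 02345; 012 0123 0134 0234 0345 01245; 012 0123 0134 0345 1345 01235; 012 0123 0134 0345 1345 01245; 012 0123 0134 0345 1345 02345; 012 0123 0134 0345 2345 01235; 012 0123 0134 0345 2345 01245; 012 0123 0134 0345 2345 12345; 012 0123 0145 0345 1345 01234; 012 0123 0145 0345 1345 02345; 012 0123 0145 0345 2345 01234; 012 0123 0145 0345 2345 12345; 012 0123 0124 0134 2345 02345 12345; 012 0123 0124 0135 2345 02345 12345; 012 0123 0134 0135 0345 01245 02345; 012 0123 0134 0145 0345 01235 02345; 012 0123 0345 1345 2345 01234 01245; 012 0123 0124 0135 2345 01245 01345 02345; 012 0123 0124 0345 1345 01235 02345 12345; 012 0123 0124 0134 2345 01235 01245 01345 02345; 012 0123 0124 0134 0135 0245; 012 0123 0124 0134 0135 2345; 012 0123 0124 0134 0234 0345; 012 0123 0124 0134 0235 0245; 012 0123 0124 0134 0345 1345; 012 0123 0124 0134 0345 2345; 012 0123 0124 0135 0245 0345; 012 0123 0124 0345 1345 2345; 012 0123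 0124 0125 0134 2345 02345; 012 0123 0124 0134 0135 0345 02345; 012 0123 0124 0134 0235 0345 01245; 012 0123 0124 0125 0134 0135 0345; 012 013 02345 12345; 012 034 01235 01245 01345 12345; 012 345 01234 01235 01245 01345 02345 12345; 012 013 0234; 012 034 1234; 012 013 0145 02345; 012 013 0245 12345; 012 013 2345 02345; 012 034 0135 01245; 012 034 0135 12345; 012 034 1235 01345; 012 013 0245 01345 02345; 012 034 0123 01245 12345; 012 034 0123 01345 12345; 012 034 1235 01245 12345; 012 013 0245 01234 01235 01345; 012 013 0245 01234 01235 02345; 012 013 2345 01234 01245 01345; 012 034 0125 01235 01345 12345; 012 034 0125 01345 02345 12345; 012 345 0134 01235 01245 02345; 012 013 0145 0245; 012 013 0145 2345; 012 013 0245 1245; 012 013 0245 1345; 012 034 0123 0145; 012 034 0123 1345; 012 345 0134 0235; 012 013 0124 0245 01345; 012 013 0124 0245 02345; 012 013 0124 0345 01235; 012 013 0124 0345 01245; 012 013 0124 0345 02345; 012 013 0124 2345 01345; 012 034 0123 0124 12345; 012 034 0123 0134 12345; 012 034 0123 1235 01245; 012 034 0123 1245 01235; 012 034 0125 1235 01245;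 012 034 0125 1235 12345; 012 034 0125 1345 02345; 012 034 0125 1345 12345; 012 345 0134 0135 01245; 012 345 0134 0135 02345; 012 013 0124 2345 01235 01245; 012 345 0123 0134 01245 02345; 012 345 0123 0134 02345 12345; 012 345 0123 0145 02345 12345; 012 034 0123 0134 01235 01245 01345 02345; 012 345 0123 0124 01235 01345 02345 12345; 012 345 0123 0345 01234 01235 01245 01345 12345; 012 013 0124 0125 0245; 012 013 0124 0134 0245; 012 013 0124 0134 2345; 012 013 0124 0135 2345; 012 034 0123 0124 1235; 012 034 0123 0125 0135; 012 034 0123 0125 1235; 012 034 0123 0134 0135; 012 034 0123 0135 0345; 012 034 0123 0345 1235; 012 034 0123 0345 1245; 012 034 0125 0345 1235; 012 345 0123 0134 0145; 012 345 0123 0134 0234; 012 345 0123 0145 0245; 012 034 0123 0124 0134 02345; 012 034 0123 0125 0345 12345; 012 345 0123 0124 0135 02345; 012 345 0123 0134 0345 01245; 012 345 0123 0134 2345 01245; 012 034 0123 0125 0134 01245 02345; 012 345 0123 0134 2345 01235 02345; 012 345 0123 0145 2345 01234 02345; 012 034 0123 0124 0134 0234; 012 345 0123 0124 0134 2345; 012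 345 0123 0124 0135 0345; 012 345 0123 0124 0135 2345; 012 034 0123 0124 0125 0345 01345 02345; 012 345 0123 0124 0345 1345 01235 01245; 012 345 0123 0124 0345 1345 01235 02345; 012 013 014; 012 013 023; 012 013 024; 012 013 045; 012 013 234; 012 034 135; 012 013 245 02345; 012 013 245 01234 01345; 012 013 245 0245; 012 013 245 0124 01235; 012 013 245 2345 01234; 012 013 245 2345 01345; 01; 0. The collection $\mathcal N_c^6$: 0123 0124 0134 0234 12345; 0123 0124 0125 0134 02345 12345; 0123 0124 0135 0145 02345 12345; 0123 0124 0135 0245 01345 02345 12345; 0123 0124 0134 0235 01245 01345 02345 12345; 0123 0124 0135 2345 01245 01345 02345 12345; 0123 0124 0345 1345 01235 01245 02345 12345; 0123 0124 0134 2345 01235 01245 01345 02345 12345; 0123 0124 0134 0235 1235; 0123 0124 0134 0235 2345; 0123 0124 0135 0145 2345; 0123 0124 0135 0245 1345; 0123 0124 0125 0134 2345 02345; 0123 0124 0134 0235 1245 01345; 0123 0124 0125 0134 0135 0245; 0123 0124 0125 0134 0235 0345; 0123 0124 0134 0235 0245 0345; 012 0134 0235 12345; 012 0134 0234 01345 02345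 12345; 012 0134 0345 01235 02345 12345; 012 0123 0134 01245 01345 02345 12345; 012 0134 2345 01235 01345 02345 12345; 012 0123 0145 01234 01235 01345 02345 12345; 012 0134 0135 0234 02345; 012 0134 0234 1345 02345; 012 0134 0345 2345 01235; 012 0123 0134 0345 02345 12345; 012 0123 0145 0345 02345 12345; 012 0134 0135 0345 01245 02345; 012 0123 0124 0134 01235 02345 12345; 012 0123 0124 0134 01345 02345 12345; 012 0123 0124 0135 01245 02345 12345; 012 0123 0124 0135 01345 02345 12345; 012 0123 0134 2345 01235 02345 12345; 012 0123 0134 2345 01345 02345 12345; 012 0123 0145 2345 01234 02345 12345; 012 0123 0145 2345 01345 02345 12345; 012 0123 0134 2345 01235 01245 01345 02345; 012 0123 0145 2345 01234 01235 01345 02345; 012 0123 0345 1345 01234 01245 02345 12345; 012 0123 0134 0135 0245; 012 0123 0134 0135 2345; 012 0123 0134 0145 0235; 012 0123 0134 0145 0245; 012 0123 0134 0145 2345; 012 0123 0134 0345 2345; 012 0123 0145 0345 1345; 012 0123 0145 0345 2345; 012 0123 0124 0135 0345 12345; 012 0123 0134 0135 0345 02345; 012 0123 0134 0145 0345 02345;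 012 0123 0134 0235 0345 01245; 012 0123 0134 0245 0345 01235; 012 0123 0124 0135 2345 01245 02345; 012 0123 0124 0135 2345 01345 02345; 012 0123 0124 0345 1345 02345 12345; 012 0123 0145 0245 0345 01234 01235; 012 0123 0124 0125 0345 01345 02345 12345; 012 0123 0124 0134 2345 01235 01245 02345; 012 0123 0124 0134 2345 01235 01345 02345; 012 0123 0124 0345 1345 01235 01245 02345; 012 0123 0124 0125 0345 1345; 012 0123 0124 0134 0235 0345; 012 0123 0124 0135 0145 0345; 012 0123 0124 0125 0134 0345 02345; 012 0123 0124 0125 0134 2345 01345; 012 0123 0124 0134 0135 0345 01245; 012 0123 0124 0125 0134 0234 01345 02345; 012 0123 0124 0125 0134 0235 01345 02345; 012 034 01235 01345 12345; 012 034 1235 01245; 012 013 0245 01234 01345; 012 013 0245 01234 02345; 012 013 2345 01245 01345; 012 013 2345 01234 01235 01245; 012 034 0125 01235 01245 12345; 012 345 0123 01234 01245 01345 02345 12345; 012 013 0124 0345; 012 034 0123 0135; 012 034 0123 1245; 012 034 0125 1345; 012 013 0124 0245 01235; 012 013 0124 2345 01235; 012 013 0124 2345 01245; 012 034 0123 0125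 12345; 012 034 0123 1235 12345; 012 034 0123 0345 01235 12345; 012 034 0125 0345 01235 12345; 012 345 0123 0145 01234 02345; 012 034 0123 0134 01235 01245 02345; 012 034 0125 0135 0345; 012 345 0123 0134 0135; 012 345 0123 0124 0134 02345; 012 345 0123 0134 2345 01235; 012 345 0123 0134 2345 02345; 012 345 0123 0145 2345 01234; 012 034 0123 0124 0125 01345 02345; 012 345 0123 0134 0345 01235 02345; 012 034 0123 0125 0345 01245 01345 02345; 012 345 0123 0124 0345 01235 01345 12345; 012 345 0123 0124 0345 01345 02345 12345; 012 034 0123 0124 0345 01235 01245 01345 02345; 012 345 0123 0124 0125 0134; 012 345 0123 0124 0134 0345; 012 013 0124 0125 0134 0135 02345; 012 345 0123 0124 0125 0345 12345; 012 345 0123 0124 0345 1345 01235; 012 345 0123 0124 0125 0345 01345 02345; 012 013 0124 0125 0134 0135 0145; 012 034 0123 0124 0125 0134 0345; 012 013 245 01345; 012 013 245 01234 01235; 012 013 245 0124; 012 013 245 0134; 012 013 245 2345. -/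

import Mathlib

/-- A family is a finite set of finite sets of natural numbers. -/
abbrev Family := Finset (Finset ℕ)

/-- The union of all members of a family. -/
def Family.support (F : Family) : Finset ℕ := F.sup id

/-- The collection of all families over `{0, 1, ..., n - 1}`. -/
def familiesOver (n : ℕ) : Set Family := {F | F.support ⊆ Finset.range n}

/-- The union-closure of a family: the least family that contains `F` and is closed under
(binary) unions. On `Finset ℕ` the join `⊔` is `∪`, so this is Mathlib's `supClosure`. The empty
set belongs to the closure of `F` only if it belongs to `F`. -/
def Family.closure (F : Family) : Set (Finset ℕ) := supClosure (F : Set (Finset ℕ))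

/-- Two families are isomorphic if some bijection between their unions maps one to the other. -/
def Family.Iso (F F' : Family) : Prop :=
  ∃ f : ℕ → ℕ, Set.BijOn f (F.support : Set ℕ) (F'.support : Set ℕ) ∧
    F.image (fun A => A.image f) = F'

/-- `F` is FC-covered by the family `G`. -/
def Family.FCCoveredBy (F G : Family) : Prop :=
  ∃ G' : Family, G'.Iso G ∧ (G' : Set (Finset ℕ)) ⊆ F.closure

/-- `F` is nonFC-covered by the family `N`. -/
def Family.NonFCCoveredBy (F N : Family) : Prop :=
  ∃ N' : Family, N'.Iso N ∧ F.closure ⊆ N'.closure ∪ {∅}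

/-- `F` is covered by the two collections `𝓕` and `𝓝`: it is FC-covered by a member of `𝓕` or
nonFC-covered by a member of `𝓝`. -/
def Family.Covered (F : Family) (𝓕 𝓝 : Set Family) : Prop :=
  (∃ G ∈ 𝓕, F.FCCoveredBy G) ∨ (∃ N ∈ 𝓝, F.NonFCCoveredBy N)

/-- A collection of families is covered if each of its members is. -/
def CollectionCovered (𝓒 𝓕 𝓝 : Set Family) : Prop := ∀ F ∈ 𝓒, F.Covered 𝓕 𝓝

/-- The subset of `{0, ..., 5}` with binary code `m`: it contains `i` iff bit `i` of `m` is `1`.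
For example, `7 = 2^0 + 2^1 + 2^2` is the code of `{0, 1, 2}`. -/
def setOfCode (m : ℕ) : Finset ℕ := {i ∈ Finset.range 6 | m.testBit i}

/-- The family whose members are the sets with codes in the given list. -/
def familyOfCodes (l : List ℕ) : Family := (l.map setOfCode).toFinset

/-- The codes of the 197 characteristic FC-families over `{0, ..., 5}`. Each inner list is one
family; the families are ordered by the numbers of their members of size 0, 1, ..., 6. -/
def fc6Codes : List (List ℕ) := [
  [15,23,27,29,47,62], [15,23,39,27,59,61,62], [15,23,27,29,30], [15,23,27,29,46],
  [15,23,39,27,45,62], [15,23,39,27,57,62], [15,23,39,57,58,61], [15,23,27,45,53,62],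
  [15,23,27,45,46,55], [15,23,27,45,54,61], [15,23,27,45,60,55], [15,23,27,45,60,62],
  [15,23,43,51,60,61], [15,23,43,53,57,62], [15,23,43,53,58,61], [15,23,39,27,60,59,61],
  [15,23,39,27,60,61,62], [15,23,39,27,43,29], [15,23,39,27,43,60], [15,23,39,27,29,57],
  [15,23,39,27,45,54], [15,23,39,27,43,51,61], [15,23,39,27,43,53,61], [7,27,43,61,62],
  [7,27,29,47,62], [7,27,45,55,62], [7,27,45,59,62], [7,27,57,47,55,62], [7,27,60,47,55,61,62],
  [7,15,27,47,55,59,61,62], [7,57,58,31,47,55,61,62], [7,27,29,30], [7,27,29,46], [7,27,45,54],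
  [7,27,45,58], [7,15,27,29,62], [7,15,27,45,62], [7,15,27,53,62], [7,15,51,53,62],
  [7,27,43,51,61], [7,27,43,29,55], [7,27,43,53,61], [7,27,43,57,62], [7,27,43,60,55],
  [7,27,43,60,61], [7,27,29,57,62], [7,27,29,58,47], [7,27,29,58,62], [7,15,27,57,55,62],
  [7,27,57,58,47,55], [7,27,57,58,47,61], [7,27,57,60,47,55], [7,27,57,60,47,62],
  [7,15,27,57,47,61,62], [7,15,27,60,55,61,62], [7,15,51,57,31,61,62], [7,15,23,27,47,55,61,62],
  [7,15,23,27,47,59,61,62], [7,15,27,60,47,59,61,62], [7,15,51,60,31,59,61,62], [7,15,27,43,29],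
  [7,15,27,51,29], [7,15,27,29,58], [7,15,51,53,58], [7,27,43,51,57], [7,27,43,29,45],
  [7,27,43,29,57], [7,27,43,57,58], [7,27,29,57,58], [7,15,23,27,57,62], [7,15,27,51,53,61],
  [7,15,27,29,57,55], [7,15,27,57,58,47], [7,15,27,57,58,55], [7,15,27,57,58,61],
  [7,15,27,57,60,47], [7,15,27,57,60,55], [7,15,27,57,60,62], [7,15,51,57,58,31],
  [7,15,51,57,58,61], [7,15,51,57,60,31], [7,15,51,57,60,62], [7,15,23,27,60,61,62],
  [7,15,23,43,60,61,62], [7,15,27,43,57,55,61], [7,15,27,51,57,47,61], [7,15,57,58,60,31,55],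
  [7,15,23,43,60,55,59,61], [7,15,23,57,58,47,61,62], [7,15,23,27,60,47,55,59,61],
  [7,15,23,27,43,53], [7,15,23,27,43,60], [7,15,23,27,29,57], [7,15,23,27,45,53],
  [7,15,23,27,57,58], [7,15,23,27,57,60], [7,15,23,43,53,57], [7,15,23,57,58,60],
  [7,15,23,39,27,60,61], [7,15,23,27,43,57,61], [7,15,23,27,45,57,55], [7,15,23,39,27,43,57],
  [7,11,61,62], [7,25,47,55,59,62], [7,56,31,47,55,59,61,62], [7,11,29], [7,25,30], [7,11,51,61],
  [7,11,53,62], [7,11,60,61], [7,25,43,55], [7,25,43,62], [7,25,46,59], [7,11,53,59,61],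
  [7,25,15,55,62], [7,25,15,59,62], [7,25,46,55,62], [7,11,53,31,47,59], [7,11,53,31,47,61],
  [7,11,60,31,55,59], [7,25,39,47,59,62], [7,25,39,59,61,62], [7,56,27,47,55,61], [7,11,51,53],
  [7,11,51,60], [7,11,53,54], [7,11,53,58], [7,25,15,51], [7,25,15,58], [7,56,27,45],
  [7,11,23,53,59], [7,11,23,53,61], [7,11,23,57,47], [7,11,23,57,55], [7,11,23,57,61],
  [7,11,23,60,59], [7,25,15,23,62], [7,25,15,27,62], [7,25,15,46,55], [7,25,15,54,47],
  [7,25,39,46,55], [7,25,39,46,62], [7,25,39,58,61], [7,25,39,58,62], [7,56,27,43,55],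
  [7,56,27,43,61], [7,11,23,60,47,55], [7,56,15,27,55,61], [7,56,15,27,61,62],
  [7,56,15,51,61,62], [7,25,15,27,47,55,59,61], [7,56,15,23,47,59,61,62],
  [7,56,15,57,31,47,55,59,62], [7,11,23,39,53], [7,11,23,27,53], [7,11,23,27,60],
  [7,11,23,43,60], [7,25,15,23,46], [7,25,15,39,43], [7,25,15,39,46], [7,25,15,27,43],
  [7,25,15,43,57], [7,25,15,57,46], [7,25,15,57,54], [7,25,39,57,46], [7,56,15,27,51],
  [7,56,15,27,29], [7,56,15,51,53], [7,25,15,23,27,61], [7,25,15,39,57,62], [7,56,15,23,43,61],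
  [7,56,15,27,57,55], [7,56,15,27,60,55], [7,25,15,39,27,55,61], [7,56,15,27,60,47,61],
  [7,56,15,51,60,31,61], [7,25,15,23,27,29], [7,56,15,23,27,60], [7,56,15,23,43,57],
  [7,56,15,23,43,60], [7,25,15,23,39,57,59,61], [7,56,15,23,57,58,47,55],
  [7,56,15,23,57,58,47,61], [7,11,19], [7,11,13], [7,11,21], [7,11,49], [7,11,28], [7,25,42],
  [7,11,52,61], [7,11,52,31,59], [7,11,52,53], [7,11,52,23,47], [7,11,52,60,31], [7,11,52,60,59],
  [3], [1]]

/-- The codes of the 115 characteristic nonFC-families over `{0, ..., 5}`. Each inner list is the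
irreducible generating family of a maximal union-closed nonFC-family. -/
def nc6Codes : List (List ℕ) := [
  [15,23,27,29,62], [15,23,39,27,61,62], [15,23,43,51,61,62], [15,23,43,53,59,61,62],
  [15,23,27,45,55,59,61,62], [15,23,43,60,55,59,61,62], [15,23,57,58,47,55,61,62],
  [15,23,27,60,47,55,59,61,62], [15,23,27,45,46], [15,23,27,45,60], [15,23,43,51,60],
  [15,23,43,53,58], [15,23,39,27,60,61], [15,23,27,45,54,59], [15,23,39,27,43,53],
  [15,23,39,27,45,57], [15,23,27,45,53,57], [7,27,45,62], [7,27,29,59,61,62], [7,27,57,47,61,62],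
  [7,15,27,55,59,61,62], [7,27,60,47,59,61,62], [7,15,51,31,47,59,61,62], [7,27,43,29,61],
  [7,27,29,58,61], [7,27,57,60,47], [7,15,27,57,61,62], [7,15,51,57,61,62], [7,27,43,57,55,61],
  [7,15,23,27,47,61,62], [7,15,23,27,59,61,62], [7,15,23,43,55,61,62], [7,15,23,43,59,61,62],
  [7,15,27,60,47,61,62], [7,15,27,60,59,61,62], [7,15,51,60,31,61,62], [7,15,51,60,59,61,62],
  [7,15,27,60,47,55,59,61], [7,15,51,60,31,47,59,61], [7,15,57,58,31,55,61,62], [7,15,27,43,53],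
  [7,15,27,43,60], [7,15,27,51,45], [7,15,27,51,53], [7,15,27,51,60], [7,15,27,57,60],
  [7,15,51,57,58], [7,15,51,57,60], [7,15,23,43,57,62], [7,15,27,43,57,61], [7,15,27,51,57,61],
  [7,15,27,45,57,55], [7,15,27,53,57,47], [7,15,23,43,60,55,61], [7,15,23,43,60,59,61],
  [7,15,23,57,58,61,62], [7,15,51,53,57,31,47], [7,15,23,39,57,59,61,62],
  [7,15,23,27,60,47,55,61], [7,15,23,27,60,47,59,61], [7,15,23,57,58,47,55,61],
  [7,15,23,39,57,58], [7,15,23,27,45,57], [7,15,23,43,51,57], [7,15,23,39,27,57,61],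
  [7,15,23,39,27,60,59], [7,15,23,27,43,57,55], [7,15,23,39,27,29,59,61],
  [7,15,23,39,27,45,59,61], [7,25,47,59,62], [7,25,46,55], [7,11,53,31,59], [7,11,53,31,61],
  [7,11,60,55,59], [7,11,60,31,47,55], [7,25,39,47,55,62], [7,56,15,31,55,59,61,62],
  [7,11,23,57], [7,25,15,43], [7,25,15,54], [7,25,39,58], [7,11,23,53,47], [7,11,23,60,47],
  [7,11,23,60,55], [7,25,15,39,62], [7,25,15,46,62], [7,25,15,57,47,62], [7,25,39,57,47,62],
  [7,56,15,51,31,61], [7,25,15,27,47,55,61], [7,25,39,43,57], [7,56,15,27,43],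
  [7,56,15,23,27,61], [7,56,15,27,60,47], [7,56,15,27,60,61], [7,56,15,51,60,31],
  [7,25,15,23,39,59,61], [7,56,15,27,57,47,61], [7,25,15,39,57,55,59,61],
  [7,56,15,23,57,47,59,62], [7,56,15,23,57,59,61,62], [7,25,15,23,57,47,55,59,61],
  [7,56,15,23,39,27], [7,56,15,23,27,57], [7,11,23,39,27,43,61], [7,56,15,23,39,57,62],
  [7,56,15,23,57,58,47], [7,56,15,23,39,57,59,61], [7,11,23,39,27,43,51], [7,25,15,23,39,27,57],
  [7,11,52,59], [7,11,52,31,47], [7,11,52,23], [7,11,52,27], [7,11,52,60]]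

/-- The collection of characteristic FC-families. -/
def FC6 : Set Family := {F | ∃ l ∈ fc6Codes, F = familyOfCodes l}

/-- The collection of characteristic nonFC-families. -/
def NC6 : Set Family := {F | ∃ l ∈ nc6Codes, F = familyOfCodes l}

/-! Both kinds of covering refer only to the union-closure U of F, so the claim concerns
union-closed families U of subsets of {0, ..., 5}, and it is invariant under the permutations of {0,
..., 5}. There are finitely many such U, but far too many to list; a decision tree with symmetry
breaking handles them all.

A node of the tree records a list I of sets known to lie in U and a list A that contains all
nonempty members of U. An inner node asks whether a set s lies in U. A branch ends in one of two
ways. Either the unions of sets in I already contain a copy of a listed FC-family, and then so does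
every larger U; or every set in A is a union of members of a copy of a listed nonFC-family, and then
so is every nonempty member of U.

Symmetry keeps the tree small. Suppose a permutation sends r to s, maps A into itself, and sends I
to sets whose unions include all of I. If r is in U, then the image of U meets the conditions of the
branch "s is in U", which is treated once. So the other branch may discard r together with s.

`SearchTree.settled` proves that an accepted tree settles every U meeting the conditions at its
root, `check_searchTree` runs the checker on one explicit tree, and `covered_of_settled` turns
relabellings into the isomorphic copies that the definition of covering requires. -/

/-! ### Settled families and the format of the certificate. -/

/-- A map that permutes `{0, ..., 5}`. -/
def IsRelabelling (f : ℕ → ℕ) : Prop := (Finset.range 6).image f = Finset.range 6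

/-- The image of `U` under some relabelling contains a family of `fc6Codes`, or is contained, up to
the empty set, in the closure of a family of `nc6Codes`. -/
def Settled (U : Set (Finset ℕ)) : Prop :=
  (∃ l ∈ fc6Codes, ∃ f, IsRelabelling f ∧ ∀ A ∈ familyOfCodes l, ∃ s ∈ U, s.image f = A) ∨
  (∃ l ∈ nc6Codes, ∃ f, IsRelabelling f ∧
    ∀ s ∈ U, s.Nonempty → s.image f ∈ (familyOfCodes l).closure)

/-- The `i`-th decimal digit of `p`, counted from the right. A permutation of `{0, ..., 5}` is
encoded by the number whose digits are its values. -/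
def digit (p i : ℕ) : ℕ := p / 10 ^ i % 10

/-- The code of the image of the set with code `c` under `digit p`. -/
def relabel (p c : ℕ) : ℕ :=
  [0, 1, 2, 3, 4, 5].foldl
    (fun acc i => if c.testBit i = true then Nat.lor acc (2 ^ digit p i) else acc) 0

/-- Tests whether the nonzero code `c` is a union of codes from `l`. -/
def generates (l : List ℕ) (c : ℕ) : Bool :=
  Nat.beq (l.foldl (fun acc g => bif Nat.beq (Nat.lor g c) c then Nat.lor acc g else acc) 0) c &&
    !(Nat.beq c 0)

/-- A search tree for the proof that every union-closed family over `{0, ..., 5}` is settled.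
A leaf names a family of `fc6Codes` or `nc6Codes` and a relabelling. A node `split s l t₁ t₂`
distinguishes whether the set with code `s` is a member (`t₁`) or not (`t₂`); for the codes `r` that
symmetries listed in `l` send to `s`, membership is reduced to `t₁`. -/
inductive SearchTree where
  | fc (i p : ℕ) : SearchTree
  | nc (i p : ℕ) : SearchTree
  | split (s : ℕ) (l : List (ℕ × ℕ)) (t₁ t₂ : SearchTree) : SearchTree

/-- Checks a search tree for the families that contain the sets with codes in `I` and whose
nonempty members have codes in `A`. -/
def SearchTree.check : SearchTree → List ℕ → List ℕ → Bool
  | .fc i p, I, _ => Nat.beq (relabel p 63) 63 &&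
      match fc6Codes[i]? with
      | some l => l.all (generates (I.map (relabel p)))
      | none => false
  | .nc i p, _, A => Nat.beq (relabel p 63) 63 &&
      match nc6Codes[i]? with
      | some l => A.all fun c => generates l (relabel p c)
      | none => false
  | .split s l t₁ t₂, I, A =>
      t₁.check (s :: I) A &&
      -- For `rp = (r, p)`, the permutation must send `r` to `s` and preserve the state. For `I` it
      -- is enough that the images generate `I`, because U is union-closed.
      l.all (fun rp => Nat.beq (relabel rp.2 63) 63 && Nat.beq (relabel rp.2 rp.1) s &&
        I.all (generates (I.map (relabel rp.2))) &&
        A.all fun c => A.any (Nat.beq (relabel rp.2 c))) &&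
      t₂.check I (A.filter fun c => !(Nat.beq c s || l.any fun rp => Nat.beq c rp.1))

/-! ### Subsets of {0, ..., 5} as bit codes. -/

theorem mem_setOfCode {i m : ℕ} : i ∈ setOfCode m ↔ i < 6 ∧ m.testBit i = true := by
  simp [setOfCode]

theorem setOfCode_lor (a b : ℕ) : setOfCode (Nat.lor a b) = setOfCode a ⊔ setOfCode b := by
  ext i
  have h : (Nat.lor a b).testBit i = (a.testBit i || b.testBit i) := Nat.testBit_or a b i
  simp only [mem_setOfCode, h, Finset.sup_eq_union, Finset.mem_union, Bool.or_eq_true]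
  tauto

theorem setOfCode_subset (m : ℕ) : setOfCode m ⊆ Finset.range 6 := Finset.filter_subset _ _

theorem exists_setOfCode {s : Finset ℕ} (hs : s ⊆ Finset.range 6) :
    ∃ c < 64, setOfCode c = s := by
  have h : ∀ s ∈ (Finset.range 6).powerset, ∃ c < 64, setOfCode c = s := by decide +kernel
  exact h s (Finset.mem_powerset.2 hs)

/-- Bits are accumulated by "or", not by addition, so this needs no injectivity of `f`; the start
value `a` is arbitrary for the induction. -/
theorem testBit_foldl_lor (f : ℕ → ℕ) (c j : ℕ) (l : List ℕ) (a : ℕ) :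
    (l.foldl (fun acc i => if c.testBit i = true then Nat.lor acc (2 ^ f i) else acc) a).testBit j
      = true ↔ a.testBit j = true ∨ ∃ i ∈ l, c.testBit i = true ∧ f i = j := by
  induction l generalizing a with
  | nil => simp
  | cons i l ih =>
    rw [List.foldl_cons, ih]
    split_ifs with hc
    · simp [hc, or_assoc, Nat.testBit_two_pow]
    · simp [hc]

theorem testBit_relabel {p c j : ℕ} :
    (relabel p c).testBit j = true ↔ ∃ i < 6, c.testBit i = true ∧ digit p i = j := by
  rw [relabel, testBit_foldl_lor]
  have h (i : ℕ) : i ∈ [0, 1, 2, 3, 4, 5] ↔ i < 6 := by simp; omega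
  simp [h]

theorem testBit_sixtyThree {i : ℕ} : (63 : ℕ).testBit i = true ↔ i < 6 := by
  have := Nat.testBit_two_pow_sub_one 6 i
  norm_num at this
  simp [this]

/-- 63 is the code of the full set {0, ..., 5}, so a single evaluation tests whether the digits of
`p` form a permutation. -/
theorem isRelabelling_digit {p : ℕ} (hp : relabel p 63 = 63) : IsRelabelling (digit p) := by
  ext j
  rw [Finset.mem_range, ← testBit_sixtyThree, ← hp, testBit_relabel]
  simp [testBit_sixtyThree]

theorem IsRelabelling.lt {f : ℕ → ℕ} (hf : IsRelabelling f) {i : ℕ} (hi : i < 6) : f i < 6 := by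
  rw [← Finset.mem_range, ← hf]
  exact Finset.mem_image_of_mem _ (Finset.mem_range.2 hi)

/-- A surjection of a finite set onto itself is injective. -/
theorem IsRelabelling.injOn {f : ℕ → ℕ} (hf : IsRelabelling f) :
    Set.InjOn f (Finset.range 6 : Finset ℕ) :=
  Finset.card_image_iff.1 (congrArg Finset.card hf)

theorem IsRelabelling.comp {f g : ℕ → ℕ} (hg : IsRelabelling g) (hf : IsRelabelling f) :
    IsRelabelling (g ∘ f) := by
  rw [IsRelabelling, ← Finset.image_image, hf, hg]

theorem setOfCode_relabel {p : ℕ} (hp : relabel p 63 = 63) (c : ℕ) :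
    setOfCode (relabel p c) = (setOfCode c).image (digit p) := by
  ext j
  simp only [mem_setOfCode, testBit_relabel, Finset.mem_image]
  constructor
  · rintro ⟨-, i, hi, hc, rfl⟩
    exact ⟨i, ⟨hi, hc⟩, rfl⟩
  · rintro ⟨i, ⟨hi, hc⟩, rfl⟩
    exact ⟨(isRelabelling_digit hp).lt hi, i, hi, hc, rfl⟩

/-! ### Soundness of the search tree. -/

/-- A set is a union of members of `l` exactly when it is the union of all members of `l` that it
contains, and `generates` computes the latter. -/
theorem setOfCode_mem_of_generates {U : Set (Finset ℕ)} (hU : SupClosed U) {l : List ℕ}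
    (hl : ∀ g ∈ l, setOfCode g ∈ U) {c : ℕ} (hc : generates l c = true) : setOfCode c ∈ U := by
  -- The accumulator starts at 0, the code of the empty set, which need not lie in `U`; hence the
  -- alternative in the invariant. The test `c ≠ 0` in `generates` excludes it at the end.
  have key (l : List ℕ) (hl : ∀ g ∈ l, setOfCode g ∈ U) (a : ℕ) (ha : a = 0 ∨ setOfCode a ∈ U) :
      let b := l.foldl (fun acc g => bif Nat.beq (Nat.lor g c) c then Nat.lor acc g else acc) a
      b = 0 ∨ setOfCode b ∈ U := by
    induction l generalizing a with
    | nil => exact ha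
    | cons g l ih =>
      refine ih (fun x hx => hl x (List.mem_cons_of_mem _ hx)) _ ?_
      have hg := hl g List.mem_cons_self
      beta_reduce
      cases Nat.beq (Nat.lor g c) c
      · exact ha
      · right
        rw [cond_true]
        rcases ha with rfl | ha
        · have : Nat.lor 0 g = g := Nat.zero_or g
          rwa [this]
        · rw [setOfCode_lor]
          exact hU ha hg
  simp only [generates, Bool.and_eq_true, Nat.beq_eq, Bool.not_eq_true'] at hc
  obtain ⟨h₁, h₂⟩ := hc
  have := key l hl 0 (Or.inl rfl)
  simp only [h₁] at this
  rcases this with rfl | h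
  · simp at h₂
  · exact h

theorem SupClosed.image_image {U : Set (Finset ℕ)} (hU : SupClosed U) (f : ℕ → ℕ) :
    SupClosed ((fun s => s.image f) '' U) := by
  rintro _ ⟨s, hs, rfl⟩ _ ⟨t, ht, rfl⟩
  exact ⟨s ⊔ t, hU hs ht, Finset.image_union s t⟩

/-- Relabellings compose, so a witness for the image of `U` gives one for `U`. This justifies
passing to a symmetric copy in the search. -/
theorem Settled.of_image {U : Set (Finset ℕ)} {f : ℕ → ℕ} (hf : IsRelabelling f)
    (h : Settled ((fun s => s.image f) '' U)) : Settled U := by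
  rcases h with ⟨l, hl, g, hg, h⟩ | ⟨l, hl, g, hg, h⟩
  · refine Or.inl ⟨l, hl, g ∘ f, hg.comp hf, fun A hA => ?_⟩
    obtain ⟨_, ⟨s, hs, rfl⟩, rfl⟩ := h A hA
    exact ⟨s, hs, Finset.image_image.symm⟩
  · refine Or.inr ⟨l, hl, g ∘ f, hg.comp hf, fun s hs hne => ?_⟩
    rw [← Finset.image_image]
    exact h _ ⟨s, hs, rfl⟩ (hne.image f)

theorem mem_familyOfCodes {l : List ℕ} {s : Finset ℕ} :
    s ∈ familyOfCodes l ↔ ∃ c ∈ l, setOfCode c = s := by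
  simp [familyOfCodes]

theorem setOfCode_mem_image {U : Set (Finset ℕ)} {I : List ℕ} (hI : ∀ c ∈ I, setOfCode c ∈ U)
    {p : ℕ} (hp : relabel p 63 = 63) :
    ∀ c ∈ I.map (relabel p), setOfCode c ∈ (fun s => s.image (digit p)) '' U := by
  intro c hc
  obtain ⟨d, hd, rfl⟩ := List.mem_map.1 hc
  exact ⟨_, hI d hd, (setOfCode_relabel hp d).symm⟩

/-- Induction on the tree. `U` must vary along with `I` and `A`, since the symmetry step applies the
induction hypothesis to an image of `U`. -/
theorem SearchTree.settled {t : SearchTree} {I A : List ℕ} (h : t.check I A = true)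
    {U : Set (Finset ℕ)} (hU : SupClosed U) (hI : ∀ c ∈ I, setOfCode c ∈ U)
    (hA : ∀ s ∈ U, s.Nonempty → ∃ c ∈ A, setOfCode c = s) : Settled U := by
  induction t generalizing I A U with
  | fc i p =>
    simp only [check, Bool.and_eq_true, Nat.beq_eq] at h
    obtain ⟨hp, h⟩ := h
    split at h
    · rename_i l hl
      refine Or.inl ⟨l, List.mem_of_getElem? hl, digit p, isRelabelling_digit hp, fun B hB => ?_⟩
      obtain ⟨c, hc, rfl⟩ := mem_familyOfCodes.1 hB
      exact setOfCode_mem_of_generates (hU.image_image _) (setOfCode_mem_image hI hp)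
        (List.all_eq_true.1 h c hc)
    · exact absurd h Bool.false_ne_true
  | nc i p =>
    simp only [check, Bool.and_eq_true, Nat.beq_eq] at h
    obtain ⟨hp, h⟩ := h
    split at h
    · rename_i l hl
      refine Or.inr ⟨l, List.mem_of_getElem? hl, digit p, isRelabelling_digit hp,
        fun s hs hne => ?_⟩
      obtain ⟨c, hc, rfl⟩ := hA s hs hne
      rw [← setOfCode_relabel hp]
      exact setOfCode_mem_of_generates supClosed_supClosure
        (fun g hg => subset_supClosure (mem_familyOfCodes.2 ⟨g, hg, rfl⟩))
        (List.all_eq_true.1 h c hc)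
    · exact absurd h Bool.false_ne_true
  | split s l t₁ t₂ ih₁ ih₂ =>
    simp only [check, Bool.and_eq_true, List.all_eq_true, Nat.beq_eq] at h
    obtain ⟨⟨h₁, hl⟩, h₂⟩ := h
    -- Stated for arbitrary `V`: it serves both `U` itself and its image under a symmetry.
    have hin {V : Set (Finset ℕ)} (hV : SupClosed V) (hI : ∀ c ∈ I, setOfCode c ∈ V)
        (hA : ∀ s ∈ V, s.Nonempty → ∃ c ∈ A, setOfCode c = s) (hs : setOfCode s ∈ V) :
        Settled V :=
      ih₁ h₁ hV (List.forall_mem_cons.2 ⟨hs, hI⟩) hA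
    by_cases hs : setOfCode s ∈ U
    · exact hin hU hI hA hs
    by_cases hr : ∃ rp ∈ l, setOfCode rp.1 ∈ U
    -- Here `r` is in `U`, so the image of `U` under `p` contains `s` and still satisfies the
    -- constraints `I` and `A`.
    · obtain ⟨⟨r, p⟩, hmem, hr⟩ := hr
      obtain ⟨⟨⟨hp, hrs⟩, hIp⟩, hAp⟩ := hl _ hmem
      refine Settled.of_image (isRelabelling_digit hp) (hin (hU.image_image _) (fun c hc => ?_) ?_ ?_)
      · exact setOfCode_mem_of_generates (hU.image_image _) (setOfCode_mem_image hI hp) (hIp c hc)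
      · rintro _ ⟨s, hs, rfl⟩ hne
        obtain ⟨c, hc, rfl⟩ := hA s hs (Finset.image_nonempty.1 hne)
        obtain ⟨d, hd, hcd⟩ := List.any_eq_true.1 (hAp c hc)
        exact ⟨d, hd, by rw [← Nat.eq_of_beq_eq_true hcd, setOfCode_relabel hp]⟩
      · exact ⟨_, hr, by rw [← hrs, setOfCode_relabel hp]⟩
    -- Neither `s` nor any listed `r` is in `U`, so deleting them all from `A` loses no member of
    -- `U`.
    · refine ih₂ h₂ hU hI fun u hu hne => ?_
      obtain ⟨c, hc, rfl⟩ := hA u hu hne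
      refine ⟨c, List.mem_filter.2 ⟨hc, ?_⟩, rfl⟩
      simp only [Bool.not_eq_true', Bool.or_eq_false_iff, List.any_eq_false]
      refine ⟨?_, fun rp hrp hcr => hr ⟨rp, hrp, Nat.eq_of_beq_eq_true hcr ▸ hu⟩⟩
      rw [← Bool.not_eq_true]
      exact fun hcs => hs (Nat.eq_of_beq_eq_true hcs ▸ hu)

/-! ### From settled closures to covered families. -/

theorem IsRelabelling.image_preimage {f : ℕ → ℕ} (hf : IsRelabelling f) {B : Finset ℕ}
    (hB : B ⊆ Finset.range 6) : ((Finset.range 6).filter (f · ∈ B)).image f = B := by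
  ext j
  simp only [Finset.mem_image, Finset.mem_filter]
  constructor
  · rintro ⟨i, ⟨-, hi⟩, rfl⟩
    exact hi
  · intro hj
    obtain ⟨i, hi, rfl⟩ := Finset.mem_image.1 (hf.symm ▸ hB hj)
    exact ⟨i, ⟨hi, hj⟩, rfl⟩

theorem mem_support {F : Family} {i : ℕ} : i ∈ F.support ↔ ∃ s ∈ F, i ∈ s := by
  simp [Family.support, Finset.mem_sup]

/-- A family over `{0, ..., 5}` is isomorphic to its image under a relabelling. -/
theorem IsRelabelling.iso {f : ℕ → ℕ} (hf : IsRelabelling f) {F G : Family}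
    (hF : ∀ s ∈ F, s ⊆ Finset.range 6) (hFG : F.image (fun s => s.image f) = G) : F.Iso G := by
  subst hFG
  refine ⟨f, ⟨fun i hi => ?_, hf.injOn.mono fun i hi => ?_, fun j hj => ?_⟩, rfl⟩
  · obtain ⟨s, hs, his⟩ := mem_support.1 hi
    exact mem_support.2 ⟨_, Finset.mem_image_of_mem _ hs, Finset.mem_image_of_mem _ his⟩
  · obtain ⟨s, hs, his⟩ := mem_support.1 hi
    exact hF s hs his
  · obtain ⟨_, ht, hjt⟩ := mem_support.1 hj
    obtain ⟨s, hs, rfl⟩ := Finset.mem_image.1 ht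
    obtain ⟨i, hi, rfl⟩ := Finset.mem_image.1 hjt
    exact ⟨i, mem_support.2 ⟨s, hs, hi⟩, rfl⟩

theorem closure_subset_range {F : Family} (hF : F ∈ familiesOver 6) {s : Finset ℕ}
    (hs : s ∈ F.closure) : s ⊆ Finset.range 6 := by
  have h : F.closure ⊆ {s | s ⊆ Finset.range 6} :=
    supClosure_min (fun s hs => (Finset.le_sup (f := id) hs).trans hF)
      fun _ ha _ hb => Finset.union_subset ha hb
  exact h hs

theorem subset_range_of_mem_familyOfCodes {l : List ℕ} {s : Finset ℕ}
    (hs : s ∈ familyOfCodes l) : s ⊆ Finset.range 6 := by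
  obtain ⟨c, -, rfl⟩ := mem_familyOfCodes.1 hs
  exact setOfCode_subset c

/-- The relabelling goes from the closure of `F` to a listed family, whereas covering asks for a
copy of that family on the side of `F`. The copy is obtained by taking preimages. -/
theorem covered_of_settled {F : Family} (hF : F ∈ familiesOver 6) (h : Settled F.closure) :
    F.Covered FC6 NC6 := by
  classical
  rcases h with ⟨l, hl, f, hf, h⟩ | ⟨l, hl, f, hf, h⟩
  -- The copy consists of all sets in the closure that `f` sends into the listed family; filtering
  -- the powerset makes it a finite family.
  · refine Or.inl ⟨_, ⟨l, hl, rfl⟩, (Finset.range 6).powerset.filter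
      (fun s => s ∈ F.closure ∧ s.image f ∈ familyOfCodes l), hf.iso ?_ ?_, ?_⟩
    · exact fun s hs => Finset.mem_powerset.1 (Finset.mem_filter.1 hs).1
    · ext A
      simp only [Finset.mem_image, Finset.mem_filter, Finset.mem_powerset]
      constructor
      · rintro ⟨s, ⟨-, -, hs⟩, rfl⟩
        exact hs
      · intro hA
        obtain ⟨s, hs, rfl⟩ := h A hA
        exact ⟨s, ⟨closure_subset_range hF hs, hs, hA⟩, rfl⟩
    · exact fun s hs => (Finset.mem_filter.1 hs).2.1
  · set N : Family := (Finset.range 6).powerset.filter (fun s => s.image f ∈ familyOfCodes l)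
      with hN
    refine Or.inr ⟨_, ⟨l, hl, rfl⟩, N, hf.iso ?_ ?_, ?_⟩
    · exact fun s hs => Finset.mem_powerset.1 (Finset.mem_filter.1 hs).1
    · ext A
      simp only [hN, Finset.mem_image, Finset.mem_filter, Finset.mem_powerset]
      constructor
      · rintro ⟨s, ⟨-, hs⟩, rfl⟩
        exact hs
      · intro hA
        have := hf.image_preimage (subset_range_of_mem_familyOfCodes hA)
        exact ⟨_, ⟨Finset.filter_subset _ _, by rwa [this]⟩, this⟩
    · intro s hs
      rcases s.eq_empty_or_nonempty with rfl | hne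
      · exact Or.inr rfl
      left
      -- Preimage under `f` commutes with unions, so it carries the closure of the listed family
      -- into the closure of its copy `N`.
      have key : (familyOfCodes l).closure ⊆
          {B | B ⊆ Finset.range 6 ∧ (Finset.range 6).filter (f · ∈ B) ∈ N.closure} := by
        refine supClosure_min (fun B hB => ?_) fun B hB C hC => ?_
        · have hBr := subset_range_of_mem_familyOfCodes hB
          refine ⟨hBr, subset_supClosure (Finset.mem_filter.2
            ⟨Finset.mem_powerset.2 (Finset.filter_subset _ _), ?_⟩)⟩
          rwa [hf.image_preimage hBr]
        · refine ⟨Finset.union_subset hB.1 hC.1, ?_⟩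
          have : (Finset.range 6).filter (f · ∈ B ⊔ C) =
              (Finset.range 6).filter (f · ∈ B) ⊔ (Finset.range 6).filter (f · ∈ C) := by
            simp only [Finset.sup_eq_union, Finset.mem_union, Finset.filter_or]
          rw [this]
          exact supClosed_supClosure hB.2 hC.2
      have hs6 := closure_subset_range hF hs
      -- Injectivity of `f` on {0, ..., 5} recovers `s` as the preimage of its image, to which `key`
      -- applies.
      have hs' : (Finset.range 6).filter (f · ∈ s.image f) = s := by
        ext i
        simp only [Finset.mem_filter, Finset.mem_image]
        constructor
        · rintro ⟨hi, j, hj, hji⟩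
          rwa [← hf.injOn (hs6 hj) hi hji]
        · exact fun hi => ⟨hs6 hi, i, hi, rfl⟩
      rw [← hs']
      exact (key (h s hs hne)).2

/-! ### The certificate and the theorem. -/

set_option maxRecDepth 10000 in
/-- The search tree behind `mainTheorem1`. -/
def searchTree : SearchTree :=
  -- `543210` is the identity, and `54321` has a leading digit 0, so it sends 5 to 0. The first 21
  -- splits dispose of singletons and pairs, copies of the last two FC-families. The split at 7 then
  -- lists all other triples: either {0, 1, 2} is a member up to symmetry, or there is no triple.
  -- The split at 15 in the latter branch treats the 4-element sets in the same way.
  .split 1 [] (.fc 196 543210) (.split 2 [] (.fc 196 543201) (.split 3 [] (.fc 195 543210) (.split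
  4 [] (.fc 196 543021) (.split 5 [] (.fc 195 543120) (.split 6 [] (.fc 195 543102) (.split 8 []
  (.fc 196 540321) (.split 9 [] (.fc 195 541320) (.split 10 [] (.fc 195 541302) (.split 12 [] (.fc
  195 541032) (.split 16 [] (.fc 196 504321) (.split 17 [] (.fc 195 514320) (.split 18 [] (.fc 195
  514302) (.split 20 [] (.fc 195 514032) (.split 24 [] (.fc 195 510432) (.split 32 [] (.fc 196
  54321) (.split 33 [] (.fc 195 154320) (.split 34 [] (.fc 195 154302) (.split 36 [] (.fc 195
  154032) (.split 40 [] (.fc 195 150432) (.split 48 [] (.fc 195 105432) (.split 7 [(11, 542310),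
  (13, 542130), (14, 542103), (19, 524310), (21, 524130), (22, 524103), (25, 521430), (26,
  521403), (28, 521043), (35, 254310), (37, 254130), (38, 254103), (41, 251430), (42, 251403),
  (44, 251043), (49, 215430), (50, 215403), (52, 215043), (56, 210543)] (.split 11 [(13, 543120),
  (14, 543102), (19, 534210), (21, 534120), (22, 534102), (35, 354210), (37, 354120), (38,
  354102)] (.split 13 [] (.fc 184 543210) (.split 14 [] (.fc 184 543201) (.split 19 [] (.fc 183
  543210) (.split 21 [] (.fc 185 543210) (.split 22 [] (.fc 185 543201) (.split 25 [] (.fc 185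
  542310) (.split 26 [] (.fc 185 542301) (.split 28 [] (.fc 187 543210) (.split 29 [] (.fc 105
  543210) (.split 30 [] (.fc 105 543201) (.split 35 [] (.fc 183 453210) (.split 37 [] (.fc 185
  453210) (.split 38 [] (.fc 185 453201) (.split 41 [] (.fc 185 452310) (.split 42 [] (.fc 185
  452301) (.split 44 [] (.fc 187 453210) (.split 45 [] (.fc 105 453210) (.split 46 [] (.fc 105
  453201) (.split 49 [] (.fc 186 543210) (.split 50 [] (.fc 186 543201) (.split 52 [(56, 542310)]
  (.split 51 [] (.fc 106 435021) (.split 53 [] (.fc 191 543210) (.split 54 [] (.fc 191 543201)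
  (.split 56 [] (.fc 194 543210) (.split 57 [] (.fc 189 543210) (.split 58 [] (.fc 189 543201)
  (.split 61 [] (.fc 189 543210) (.split 62 [] (.fc 189 543201) (.split 23 [(39, 453210)] (.split
  27 [] (.fc 159 435021) (.split 39 [] (.fc 192 543210) (.split 43 [] (.fc 192 543210) (.split 47
  [] (.fc 192 543210) (.split 59 [] (.fc 190 543210) (.split 60 [] (.fc 193 543210) (.nc 112
  543210))))))) (.split 27 [(43, 453210)] (.split 43 [] (.fc 190 543210) (.split 47 [] (.fc 140
  435021) (.split 59 [] (.fc 190 543210) (.split 60 [] (.fc 193 543210) (.nc 113 543210)))))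
  (.split 60 [] (.split 31 [] (.fc 193 543210) (.split 47 [] (.fc 193 453210) (.split 59 [] (.fc
  194 543210) (.nc 114 543210)))) (.split 31 [(47, 453210)] (.split 59 [] (.fc 190 543210) (.nc
  111 543210)) (.nc 110 543210))))))))))))) (.split 53 [(54, 543201), (57, 542310), (58, 542301)]
  (.split 51 [] (.fc 123 543210) (.split 54 [] (.fc 125 543210) (.split 57 [] (.fc 113 543210)
  (.split 58 [] (.fc 126 543210) (.split 60 [] (.fc 109 543210) (.split 62 [] (.fc 108 543210)
  (.split 27 [(43, 453210)] (.split 23 [] (.fc 154 543210) (.split 39 [] (.fc 132 542310) (.split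
  43 [] (.fc 133 542310) (.split 47 [] (.fc 132 542310) (.split 59 [] (.fc 133 542310) (.split 61
  [] (.fc 134 542310) (.nc 77 542310))))))) (.split 23 [(39, 453210)] (.split 39 [] (.fc 153
  543210) (.split 59 [] (.fc 130 543210) (.split 61 [] (.fc 131 543210) (.nc 81 543210)))) (.split
  31 [(47, 453210)] (.split 47 [] (.split 59 [] (.fc 117 543210) (.split 61 [] (.fc 118 543210)
  (.nc 81 543210))) (.split 59 [] (.split 61 [] (.fc 113 543210) (.nc 71 543210)) (.nc 72
  543210))) (.split 59 [] (.split 61 [] (.fc 113 543210) (.nc 71 543210)) (.nc 72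
  543210))))))))))) (.split 23 [(27, 542310), (39, 453210), (43, 452310)] (.split 60 [] (.split 27
  [] (.fc 155 543210) (.split 39 [] (.fc 146 543210) (.split 43 [] (.fc 156 543210) (.split 51 []
  (.fc 135 543210) (.split 59 [] (.fc 135 543210) (.split 61 [] (.fc 109 543210) (.split 62 []
  (.fc 109 543201) (.split 47 [] (.split 55 [] (.fc 146 543210) (.nc 82 543210)) (.nc 83
  543210))))))))) (.split 51 [] (.split 61 [] (.fc 107 543210) (.split 62 [] (.fc 107 543201) (.nc
  108 543210))) (.split 27 [] (.split 39 [(43, 542310)] (.split 43 [] (.split 61 [(62, 543201)]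
  (.split 62 [] (.fc 102 543210) (.nc 104 543210)) (.nc 104 543210)) (.split 61 [(62, 543201)]
  (.split 62 [] (.fc 102 543210) (.nc 104 543210)) (.nc 104 543210))) (.split 61 [(62, 543201)]
  (.split 62 [] (.fc 102 543210) (.nc 104 543210)) (.nc 104 543210))) (.split 39 [] (.split 43 []
  (.split 61 [(62, 543201)] (.split 62 [] (.fc 102 543210) (.nc 104 543210)) (.nc 104 543210))
  (.split 61 [(62, 543201)] (.split 62 [] (.fc 102 543210) (.nc 104 543210)) (.nc 104 543210)))
  (.split 43 [] (.split 61 [(62, 543201)] (.split 62 [] (.fc 102 543210) (.nc 104 543210)) (.nc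
  104 543210)) (.split 61 [(62, 543201)] (.split 62 [] (.fc 102 543210) (.nc 104 543210)) (.nc 104
  543210))))))) (.split 51 [] (.split 60 [] (.fc 124 543210) (.split 61 [] (.fc 107 543210)
  (.split 62 [] (.fc 107 543201) (.nc 108 543210)))) (.split 60 [] (.split 61 [] (.fc 109 543210)
  (.split 62 [] (.fc 109 543201) (.split 31 [(47, 453210)] (.split 55 [(59, 542310)] (.split 59 []
  (.fc 119 543210) (.nc 74 543210)) (.nc 74 543210)) (.nc 73 543210)))) (.split 61 [(62, 543201)]
  (.split 62 [] (.fc 102 543210) (.nc 104 543210)) (.nc 104 543210)))))))))))))))))))))))))))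
  (.split 25 [(26, 543201), (28, 543021), (41, 453210), (42, 453201), (44, 453021), (49, 435210),
  (50, 435201), (52, 435021)] (.split 26 [] (.fc 187 510432) (.split 28 [] (.fc 187 510342)
  (.split 30 [] (.fc 106 543210) (.split 41 [] (.fc 186 321540) (.split 42 [] (.fc 188 543210)
  (.split 44 [] (.fc 188 543120) (.split 49 [] (.fc 186 312540) (.split 50 [] (.fc 188 534210)
  (.split 52 [] (.fc 188 534120) (.split 56 [] (.split 15 [] (.fc 191 310542) (.split 23 [] (.fc
  191 301542) (.split 43 [] (.fc 189 310542) (.split 45 [] (.fc 189 310542) (.split 46 [] (.fc 189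
  310542) (.split 47 [] (.fc 189 310542) (.split 51 [] (.fc 189 301542) (.split 53 [] (.fc 189
  301542) (.split 54 [] (.fc 189 301542) (.split 55 [] (.fc 189 301542) (.split 27 [(29, 543120)]
  (.split 29 [] (.fc 192 310542) (.split 39 [] (.fc 193 310542) (.split 58 [] (.fc 159 521430)
  (.split 60 [] (.fc 192 310542) (.split 61 [] (.fc 192 310542) (.split 62 [] (.fc 190 310542)
  (.nc 112 310542))))))) (.split 58 [(60, 543120)] (.split 39 [] (.fc 193 310542) (.split 60 []
  (.fc 190 310542) (.split 61 [] (.fc 140 521430) (.split 62 [] (.fc 190 310542) (.nc 113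
  310542))))) (.split 39 [] (.split 59 [] (.fc 193 310542) (.split 61 [] (.fc 193 310452) (.split
  62 [] (.fc 194 310542) (.nc 114 310542)))) (.split 59 [(61, 543120)] (.split 62 [] (.fc 190
  310542) (.nc 111 310542)) (.nc 110 310542))))))))))))))) (.split 43 [(45, 543120), (51, 534210),
  (53, 534120)] (.split 23 [] (.fc 127 534210) (.split 29 [] (.fc 127 521340) (.split 45 [] (.fc
  110 521430) (.split 46 [] (.fc 112 543210) (.split 51 [] (.fc 110 543210) (.split 53 [] (.fc 110
  543210) (.split 54 [] (.fc 112 534210) (.split 55 [] (.fc 110 543210) (.split 58 [] (.fc 112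
  521430) (.split 60 [] (.fc 112 521340) (.split 61 [] (.fc 110 521430) (.split 62 [] (.fc 111
  543210) (.split 15 [(27, 521430)] (.split 27 [] (.fc 160 543210) (.split 39 [] (.fc 158 543210)
  (.split 57 [] (.fc 161 543210) (.nc 78 543210)))) (.nc 90 543210)))))))))))))) (.split 46 [(54,
  534210), (58, 521430), (60, 521340)] (.split 27 [] (.fc 128 521430) (.split 29 [] (.fc 128
  521340) (.split 54 [] (.fc 116 543210) (.split 58 [] (.fc 112 543210) (.split 59 [] (.fc 112
  543210) (.split 60 [] (.fc 112 543120) (.split 61 [] (.fc 112 543120) (.split 23 [] (.split 15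
  [] (.fc 157 543210) (.split 39 [] (.fc 140 543210) (.split 55 [] (.fc 139 534210) (.split 57 []
  (.fc 163 534210) (.split 62 [] (.fc 114 534210) (.nc 79 534210)))))) (.split 39 [] (.split 15 []
  (.fc 159 543210) (.split 55 [] (.fc 140 543210) (.split 57 [] (.fc 164 543210) (.split 62 []
  (.fc 141 543210) (.nc 113 354102))))) (.split 57 [] (.split 15 [] (.fc 162 543210) (.split 55 []
  (.fc 142 521430) (.split 62 [] (.fc 143 521430) (.nc 80 521430)))) (.split 15 [] (.split 55 []
  (.fc 138 543210) (.nc 85 543210)) (.split 55 [] (.split 62 [] (.fc 116 543210) (.nc 70 543210))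
  (.nc 85 543210))))))))))))) (.split 15 [(23, 534210), (27, 521430), (29, 521340)] (.split 27
  [(29, 543120)] (.split 62 [] (.fc 137 543210) (.split 23 [(29, 521430)] (.split 29 [] (.fc 176
  543210) (.split 61 [] (.fc 168 543210) (.nc 109 543210))) (.split 39 [(57, 521430)] (.split 55
  [] (.split 61 [] (.fc 173 543210) (.nc 109 543210)) (.nc 109 521430)) (.split 47 [(59, 521430)]
  (.split 55 [] (.split 59 [] (.split 61 [] (.fc 150 543210) (.nc 109 543210)) (.nc 89 543210))
  (.nc 109 521430)) (.nc 89 543210))))) (.split 23 [] (.split 62 [] (.fc 136 543210) (.split 39 []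
  (.split 57 [] (.split 59 [(61, 543120)] (.split 61 [] (.fc 180 543210) (.nc 109 543210)) (.nc
  109 543210)) (.nc 96 543210)) (.nc 101 543210))) (.split 39 [] (.split 57 [] (.split 62 [] (.fc
  169 543210) (.nc 98 543210)) (.split 59 [(61, 543120)] (.split 62 [] (.fc 120 543210) (.nc 96
  543210)) (.split 55 [] (.split 62 [] (.fc 114 543210) (.nc 96 543210)) (.nc 84 543210))))
  (.split 57 [] (.split 59 [(61, 543120)] (.split 62 [] (.fc 115 543210) (.nc 98 543210)) (.split
  55 [] (.split 62 [] (.fc 114 543210) (.nc 98 543210)) (.nc 86 543210))) (.split 59 [(61,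
  543120)] (.split 62 [] (.fc 115 543210) (.nc 96 543210)) (.split 55 [] (.split 62 [] (.fc 114
  543210) (.nc 89 543210)) (.nc 84 543210))))))) (.split 39 [(57, 521430)] (.split 57 [] (.split
  47 [(55, 534210), (59, 521430), (61, 521340)] (.split 59 [(61, 543120)] (.split 62 [] (.fc 120
  543210) (.nc 98 543210)) (.split 55 [] (.split 62 [] (.fc 121 521430) (.nc 98 543210)) (.nc 87
  543210))) (.nc 87 543210)) (.split 47 [(55, 534210)] (.split 59 [(61, 543120)] (.split 62 []
  (.fc 120 543210) (.nc 96 543210)) (.nc 75 543210)) (.split 59 [(61, 543120)] (.split 61 []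
  (.split 62 [] (.fc 121 543210) (.nc 96 543210)) (.nc 86 521430)) (.nc 75 543210)))) (.split 47
  [(55, 534210), (59, 521430), (61, 521340)] (.split 59 [(61, 543120)] (.split 55 [(61, 521430)]
  (.split 62 [] (.fc 103 543210) (.nc 96 543210)) (.nc 69 543210)) (.nc 75 543210)) (.nc 69
  543210)))))))))))))))) (.split 56 [] (.split 27 [(29, 543120), (30, 543102), (43, 453210), (45,
  453120), (46, 453102), (51, 435210), (53, 435120), (54, 435102)] (.split 45 [] (.fc 129 543210)
  (.split 46 [] (.fc 129 543201) (.split 53 [] (.fc 129 534210) (.split 54 [] (.fc 129 534201)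
  (.split 29 [(30, 543201), (43, 210543), (51, 201543)] (.split 15 [] (.fc 166 543210) (.split 23
  [] (.fc 166 534210) (.split 30 [] (.fc 144 210543) (.split 39 [] (.fc 167 354210) (.split 43 []
  (.fc 145 543210) (.split 47 [] (.fc 145 210543) (.split 51 [] (.fc 145 534210) (.split 55 []
  (.fc 145 201543) (.split 58 [] (.fc 165 210534) (.split 60 [] (.fc 165 210354) (.split 62 []
  (.fc 144 210543) (.nc 91 210543)))))))))))) (.split 15 [(23, 534210), (57, 210543), (58,
  210534)] (.split 57 [(58, 543201)] (.split 39 [] (.fc 178 453210) (.split 55 [] (.fc 171 543210)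
  (.split 60 [] (.fc 178 210453) (.split 62 [] (.fc 171 210543) (.split 23 [(58, 210543)] (.split
  47 [] (.fc 171 534210) (.split 58 [] (.fc 94 543210) (.split 61 [] (.fc 72 210543) (.nc 103
  543210)))) (.nc 97 543210)))))) (.split 39 [] (.split 60 [] (.fc 179 453210) (.split 61 [] (.fc
  170 453210) (.split 62 [] (.fc 170 453201) (.nc 102 543210)))) (.split 60 [] (.split 23 [] (.fc
  177 543210) (.split 55 [] (.fc 172 543210) (.split 61 [(62, 543201)] (.split 47 [] (.fc 174
  543210) (.split 62 [] (.fc 148 543210) (.nc 94 543210))) (.nc 93 543210)))) (.split 23 []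
  (.split 61 [(62, 543201)] (.split 47 [] (.fc 147 534210) (.split 55 [] (.fc 147 543210) (.split
  62 [] (.fc 148 543210) (.nc 92 543210)))) (.nc 102 543210)) (.split 61 [(62, 543201)] (.split 55
  [] (.fc 147 543210) (.split 62 [] (.fc 148 543210) (.nc 97 543210))) (.nc 102 543210))))))
  (.split 39 [(60, 210543)] (.split 60 [] (.split 47 [(55, 534210), (61, 210543), (62, 210534)]
  (.split 55 [] (.fc 149 210354) (.split 61 [] (.fc 175 354210) (.split 62 [] (.fc 175 354201)
  (.nc 95 354210)))) (.nc 95 354210)) (.split 61 [(62, 543201)] (.split 62 [] (.fc 149 354210)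
  (.split 47 [(55, 534210)] (.split 55 [] (.fc 122 543210) (.nc 88 354210)) (.nc 88 354210))) (.nc
  102 543210))) (.split 47 [(55, 534210), (61, 210543), (62, 210534)] (.split 61 [(62, 543201)]
  (.split 55 [] (.fc 122 543210) (.split 62 [] (.fc 122 210543) (.nc 88 354210))) (.nc 102
  543210)) (.nc 88 354210))))))))) (.split 15 [(23, 534210), (39, 354210), (57, 210543), (58,
  210534), (60, 210354)] (.split 57 [(58, 543201), (60, 543021)] (.split 23 [(39, 453210), (58,
  210543), (60, 210453)] (.split 58 [(60, 543120)] (.split 39 [] (.fc 181 543210) (.split 60 []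
  (.fc 181 210543) (.split 47 [(55, 534210), (61, 210543), (62, 210534)] (.split 55 [] (.fc 181
  543210) (.split 61 [] (.fc 182 543210) (.split 62 [] (.fc 182 543201) (.nc 106 543210)))) (.nc
  106 543210)))) (.split 39 [] (.split 59 [(61, 543120)] (.split 62 [] (.fc 152 543210) (.nc 107
  543210)) (.nc 105 543210)) (.split 47 [(55, 534210)] (.split 59 [(61, 543120)] (.split 62 []
  (.split 55 [] (.fc 152 543210) (.split 61 [] (.fc 152 201543) (.nc 99 543210))) (.nc 107
  543210)) (.nc 105 543210)) (.nc 100 543210)))) (.split 31 [(47, 453210), (59, 210543), (61,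
  210453)] (.split 59 [(61, 543120)] (.split 47 [(61, 210543)] (.split 55 [] (.split 62 [] (.fc
  152 543210) (.nc 107 543210)) (.nc 107 210543)) (.nc 99 534210)) (.nc 105 543210)) (.nc 95
  543102))) (.split 23 [(39, 453210)] (.split 39 [] (.split 59 [(61, 543120), (62, 543102)]
  (.split 61 [(62, 543201)] (.split 62 [] (.fc 151 543210) (.nc 107 543210)) (.nc 102 543210))
  (.nc 102 543210)) (.split 59 [(61, 543120), (62, 543102)] (.split 47 [(55, 534210)] (.split 61
  [(62, 543201)] (.split 62 [] (.fc 151 543210) (.nc 107 543210)) (.nc 102 543210)) (.nc 100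
  543210)) (.nc 102 543210))) (.split 59 [(61, 543120), (62, 543102)] (.split 31 [(47, 453210)]
  (.split 61 [(62, 543201)] (.split 47 [] (.split 55 [] (.split 62 [] (.fc 104 543210) (.nc 107
  543210)) (.nc 107 210543)) (.nc 76 543210)) (.nc 100 210543)) (.nc 76 543210)) (.nc 100
  210543)))) (.split 31 [(47, 453210), (55, 435210), (59, 210543), (61, 210453), (62, 210435)]
  (.split 59 [(61, 543120), (62, 543102)] (.split 47 [(55, 534210), (61, 210543), (62, 210534)]
  (.split 61 [(62, 543201)] (.split 55 [(62, 210543)] (.split 62 [] (.fc 104 543210) (.nc 76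
  210534)) (.nc 76 534210)) (.nc 76 210543)) (.nc 76 543210)) (.nc 76 210543)) (.nc 76 543210))))
  (.split 27 [(29, 543120), (30, 543102), (43, 453210), (45, 453120), (46, 453102), (51, 435210),
  (53, 435120), (54, 435102)] (.split 45 [(46, 543201), (53, 534210), (54, 534201)] (.split 30 []
  (.fc 32 543201) (.split 46 [] (.fc 32 453021) (.split 54 [] (.fc 33 543210) (.split 58 [] (.fc
  34 543210) (.split 60 [] (.fc 34 453120) (.split 29 [(43, 453120)] (.split 15 [] (.fc 60 543120)
  (.split 23 [] (.fc 61 534120) (.split 43 [] (.fc 65 543210) (.split 51 [] (.fc 41 534210)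
  (.split 53 [] (.fc 40 543120) (.split 55 [] (.fc 40 543120) (.split 57 [] (.fc 66 543120)
  (.split 62 [] (.fc 26 453120) (.split 39 [] (.split 59 [] (.fc 70 354120) (.nc 43 354120)) (.nc
  23 543120)))))))))) (.split 51 [(53, 453120)] (.split 53 [] (.fc 41 534210) (.split 57 [] (.fc
  41 534210) (.split 61 [] (.fc 41 534210) (.split 62 [] (.fc 26 543210) (.split 15 [(39, 345210)]
  (.split 23 [] (.fc 90 534210) (.split 39 [] (.fc 93 453120) (.nc 42 543210))) (.nc 40
  534210)))))) (.split 23 [(39, 453120)] (.split 62 [] (.fc 37 534210) (.split 39 [] (.split 57 []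
  (.fc 96 435210) (.nc 68 543210)) (.split 15 [] (.split 57 [] (.split 55 [] (.fc 100 543210) (.nc
  62 543210)) (.nc 68 543210)) (.nc 52 534210)))) (.split 15 [] (.split 62 [] (.fc 36 543210) (.nc
  51 543210)) (.split 57 [] (.split 62 [] (.fc 26 543210) (.nc 51 543210)) (.split 59 [(61,
  453120)] (.split 62 [] (.fc 26 543210) (.nc 51 543210)) (.split 55 [] (.split 62 [] (.fc 25
  543210) (.nc 40 534210)) (.nc 17 543210))))))))))))) (.split 29 [(30, 543201)] (.split 30 []
  (.fc 31 543210) (.split 43 [(51, 534210)] (.split 15 [] (.fc 60 543210) (.split 23 [] (.fc 61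
  534210) (.split 51 [] (.fc 40 543210) (.split 55 [] (.fc 40 543210) (.split 57 [] (.fc 66
  543210) (.split 58 [] (.fc 46 543210) (.split 60 [] (.fc 46 543120) (.split 62 [] (.fc 26
  453210) (.split 39 [] (.split 61 [] (.fc 70 354210) (.nc 43 354210)) (.nc 23 543210))))))))))
  (.split 58 [(60, 543120)] (.split 15 [] (.fc 62 543210) (.split 23 [] (.fc 62 534210) (.split 39
  [] (.fc 63 354210) (.split 47 [] (.fc 46 543210) (.split 55 [] (.fc 46 534210) (.split 57 []
  (.fc 68 543210) (.split 60 [] (.fc 47 543210) (.split 62 [] (.fc 47 543210) (.nc 24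
  543210))))))))) (.split 15 [(23, 534210)] (.split 62 [] (.fc 35 543210) (.split 57 [] (.split 23
  [] (.fc 92 543210) (.split 55 [] (.fc 71 543210) (.nc 109 521430))) (.nc 67 543210))) (.split 39
  [] (.split 62 [] (.fc 38 354210) (.nc 56 354210)) (.split 57 [] (.split 62 [] (.fc 45 543210)
  (.nc 56 354210)) (.split 47 [(55, 534210)] (.split 62 [] (.fc 24 543210) (.nc 56 354210)) (.nc
  18 543210)))))))) (.split 15 [(23, 534210)] (.split 57 [(58, 543201)] (.split 58 [] (.split 23
  [] (.fc 94 543210) (.split 39 [] (.fc 78 354210) (.split 43 [] (.fc 72 543210) (.split 47 []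
  (.fc 72 543210) (.split 51 [] (.fc 78 543210) (.split 55 [] (.fc 73 543210) (.split 60 [] (.fc
  77 543210) (.split 61 [] (.fc 74 543210) (.split 62 [] (.fc 74 543201) (.nc 103 210543))))))))))
  (.split 60 [] (.split 23 [] (.fc 95 543210) (.split 39 [] (.fc 80 354210) (.split 43 [] (.fc 75
  543210) (.split 47 [] (.fc 75 543210) (.split 51 [] (.fc 80 543210) (.split 55 [] (.fc 76
  543210) (.split 62 [] (.fc 77 543210) (.nc 45 543210)))))))) (.split 43 [] (.split 51 [] (.fc 64
  543210) (.split 62 [] (.fc 42 543210) (.split 23 [(39, 453210)] (.split 39 [] (.fc 101 543210)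
  (.split 61 [] (.fc 99 543210) (.nc 66 543210))) (.split 55 [] (.split 61 [] (.fc 84 543210) (.nc
  66 543210)) (.nc 49 543210))))) (.split 23 [] (.split 62 [] (.fc 69 543210) (.split 51 []
  (.split 39 [] (.fc 101 534210) (.split 61 [] (.fc 99 534210) (.nc 66 534210))) (.nc 64 543210)))
  (.split 51 [] (.split 62 [] (.fc 48 543210) (.split 39 [] (.split 61 [] (.fc 85 543210) (.nc 63
  453210)) (.split 47 [] (.split 61 [] (.fc 85 543210) (.nc 63 453210)) (.nc 50 543210)))) (.split
  39 [] (.split 62 [] (.split 55 [] (.fc 48 543210) (.split 61 [] (.fc 55 354210) (.nc 48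
  453210))) (.nc 64 543210)) (.split 55 [] (.split 62 [] (.fc 48 543210) (.nc 51 543210)) (.split
  47 [] (.split 61 [] (.split 62 [] (.fc 53 543210) (.nc 49 543210)) (.nc 48 453210)) (.nc 26
  543210))))))))) (.split 23 [] (.split 43 [(51, 534210)] (.split 60 [] (.fc 91 543210) (.split 51
  [] (.split 61 [] (.fc 39 543210) (.split 62 [] (.fc 39 543201) (.nc 108 543210))) (.split 39 []
  (.split 61 [(62, 543201)] (.split 62 [] (.fc 57 543210) (.nc 104 543210)) (.nc 104 543210))
  (.split 61 [(62, 543201)] (.split 62 [] (.fc 57 543210) (.nc 104 543210)) (.nc 66 543210)))))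
  (.split 39 [] (.split 60 [] (.split 61 [] (.fc 98 543210) (.split 62 [] (.fc 98 543201) (.nc 65
  543210))) (.split 61 [(62, 543201)] (.split 62 [] (.fc 56 543210) (.nc 64 543210)) (.nc 64
  543210))) (.split 60 [] (.split 61 [(62, 543201)] (.split 62 [] (.fc 82 543210) (.split 47 [(55,
  534210)] (.split 55 [] (.split 59 [] (.fc 89 543210) (.nc 58 543210)) (.nc 59 543210)) (.nc 59
  543210))) (.nc 65 543210)) (.split 47 [(55, 534210)] (.split 61 [(62, 543201)] (.split 62 []
  (.split 55 [] (.fc 56 543210) (.split 59 [] (.fc 57 543210) (.nc 29 543210))) (.nc 64 543210))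
  (.nc 64 543210)) (.nc 30 543210))))) (.split 39 [] (.split 60 [] (.split 43 [] (.fc 91 453210)
  (.split 51 [] (.fc 43 534210) (.split 61 [(62, 543201)] (.split 62 [] (.fc 83 453210) (.split 55
  [] (.split 59 [] (.fc 87 453210) (.nc 53 453210)) (.nc 54 453210))) (.nc 65 543210)))) (.split
  43 [] (.split 51 [] (.split 61 [] (.fc 39 543210) (.split 62 [] (.fc 39 543201) (.nc 108
  543210))) (.split 61 [(62, 543201)] (.split 62 [] (.fc 57 453210) (.nc 104 543210)) (.nc 66
  453210))) (.split 51 [] (.split 61 [(62, 543201)] (.split 62 [] (.fc 29 543210) (.nc 104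
  534210)) (.nc 63 453210)) (.split 61 [(62, 543201)] (.split 55 [] (.split 59 [] (.split 62 []
  (.fc 29 543210) (.nc 64 543210)) (.nc 31 453210)) (.nc 32 453210)) (.nc 63 453210))))) (.split
  43 [] (.split 60 [] (.split 51 [] (.fc 43 543210) (.split 55 [] (.fc 43 543210) (.split 61 []
  (.fc 44 543210) (.split 62 [] (.fc 44 543201) (.nc 41 543210))))) (.split 51 [] (.split 61 []
  (.fc 39 543210) (.split 62 [] (.fc 39 543201) (.nc 108 543210))) (.split 61 [(62, 543201)]
  (.split 62 [] (.fc 23 543210) (.nc 104 543210)) (.nc 40 543210)))) (.split 51 [] (.split 60 []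
  (.split 47 [] (.fc 43 534210) (.split 61 [] (.fc 44 534210) (.split 62 [] (.fc 44 534201) (.nc
  44 543210)))) (.split 61 [(62, 543201)] (.split 62 [] (.fc 23 534210) (.nc 104 534210)) (.nc 42
  543210))) (.split 60 [] (.split 61 [(62, 543201)] (.split 55 [] (.split 62 [] (.fc 54 543210)
  (.nc 37 543210)) (.split 47 [] (.split 59 [] (.split 62 [] (.fc 58 543210) (.nc 37 543210)) (.nc
  33 543210)) (.nc 34 543210))) (.nc 37 543210)) (.split 61 [(62, 543201)] (.split 47 [] (.split
  55 [] (.split 59 [] (.split 62 [] (.fc 29 543210) (.nc 37 543210)) (.nc 31 453210)) (.nc 32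
  453210)) (.nc 20 543210)) (.nc 37 543210)))))))) (.split 43 [(51, 534210)] (.split 57 [(58,
  543201)] (.split 51 [] (.fc 64 543210) (.split 58 [] (.fc 67 543210) (.split 60 [] (.fc 44
  543210) (.split 62 [] (.fc 42 543210) (.split 39 [] (.split 55 [] (.split 61 [] (.fc 85 354210)
  (.nc 63 435210)) (.nc 50 354210)) (.nc 28 543210)))))) (.split 60 [] (.split 51 [] (.fc 43
  543210) (.split 55 [] (.fc 43 543210) (.split 61 [] (.fc 44 543210) (.split 62 [] (.fc 44
  543201) (.nc 44 354210))))) (.split 51 [] (.split 61 [] (.fc 39 543210) (.split 62 [] (.fc 39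
  543201) (.nc 108 543210))) (.split 39 [] (.split 61 [(62, 543201)] (.split 62 [] (.fc 23 543210)
  (.nc 104 543210)) (.nc 42 354210)) (.split 61 [(62, 543201)] (.split 62 [] (.fc 23 543210) (.nc
  28 543210)) (.nc 28 543210)))))) (.split 57 [(58, 543201)] (.split 39 [] (.split 58 [] (.split
  47 [] (.fc 78 354210) (.split 55 [] (.fc 78 345210) (.split 60 [] (.fc 81 354210) (.split 61 []
  (.fc 79 354210) (.split 62 [] (.fc 79 354201) (.nc 46 354210)))))) (.split 60 [] (.split 47 []
  (.fc 80 354210) (.split 55 [] (.fc 80 345210) (.split 62 [] (.fc 81 354210) (.nc 47 354210))))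
  (.split 47 [(55, 534210)] (.split 62 [] (.split 55 [] (.fc 27 543210) (.split 61 [] (.fc 55
  354210) (.nc 48 453210))) (.nc 52 354120)) (.nc 27 354210)))) (.split 58 [] (.split 60 []
  (.split 47 [] (.fc 52 543210) (.split 55 [] (.fc 52 534210) (.nc 102 210543))) (.split 47 [(55,
  534210)] (.split 55 [] (.fc 49 543210) (.split 61 [] (.fc 50 543210) (.split 62 [] (.fc 50
  543201) (.nc 92 210543)))) (.nc 102 210543))) (.split 60 [] (.split 47 [(55, 534210)] (.split 55
  [] (.fc 51 543210) (.split 62 [] (.fc 52 543210) (.nc 25 543210))) (.nc 102 210543)) (.split 47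
  [(55, 534210)] (.split 55 [] (.split 62 [] (.fc 27 543210) (.nc 28 543210)) (.nc 19 543210))
  (.nc 19 543210))))) (.split 39 [] (.split 60 [] (.split 47 [(55, 534210)] (.split 61 [(62,
  543201)] (.split 62 [] (.split 55 [] (.fc 28 543210) (.split 59 [] (.fc 59 354210) (.nc 35
  354210))) (.nc 38 354210)) (.nc 38 354210)) (.nc 36 354210)) (.nc 22 354210)) (.split 60 []
  (.split 47 [(55, 534210)] (.split 61 [(62, 543201)] (.split 55 [] (.split 62 [] (.fc 28 543210)
  (.nc 37 543210)) (.nc 21 543210)) (.nc 37 543210)) (.nc 21 543210)) (.nc 22 354210))))))))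
  (.split 15 [(23, 534210), (39, 354210)] (.split 57 [(58, 543201), (60, 543021)] (.split 23 [(39,
  453210)] (.split 58 [(60, 543120)] (.split 60 [] (.fc 97 543210) (.split 39 [] (.split 61 []
  (.fc 6 543210) (.split 62 [] (.fc 6 543201) (.nc 61 543210))) (.split 47 [(55, 534210)] (.split
  61 [(62, 543201)] (.split 62 [] (.fc 88 543210) (.nc 60 543210)) (.nc 60 543210)) (.nc 55
  543210)))) (.nc 57 543210)) (.split 58 [(60, 543120)] (.split 60 [] (.split 31 [(47, 453210)]
  (.split 55 [] (.fc 86 543210) (.nc 107 210543)) (.nc 105 210543)) (.split 31 [(47, 453210)]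
  (.split 61 [(62, 543201)] (.split 47 [] (.split 55 [] (.split 62 [] (.fc 30 543210) (.nc 60
  543210)) (.nc 107 210543)) (.nc 39 543210)) (.nc 60 543210)) (.nc 39 543210))) (.nc 57 543210)))
  (.nc 57 543210)) (.split 57 [(58, 543201), (60, 543021)] (.split 58 [(60, 543120)] (.split 60 []
  (.split 31 [(47, 453210), (55, 435210)] (.split 47 [(55, 534210)] (.split 55 [] (.fc 30 543210)
  (.nc 107 210543)) (.nc 102 210543)) (.nc 102 210543)) (.split 31 [(47, 453210), (55, 435210)]
  (.split 47 [(55, 534210)] (.split 61 [(62, 543201)] (.split 55 [] (.split 62 [] (.fc 30 543210)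
  (.nc 60 543210)) (.nc 39 534210)) (.nc 60 543210)) (.nc 39 543210)) (.nc 39 543210))) (.nc 57
  543210)) (.nc 22 543210))))))) (.split 15 [(23, 534210), (27, 532410), (29, 532140), (30,
  532104), (39, 354210), (43, 352410), (45, 352140), (46, 352104), (51, 325410), (53, 325140),
  (54, 325104), (57, 321540), (58, 321504), (60, 321054)] (.split 23 [(27, 542310), (29, 542130),
  (30, 542103), (39, 453210), (43, 452310), (45, 452130), (46, 452103)] (.split 43 [(45, 543120),
  (46, 543102), (51, 534210), (53, 534120), (54, 534102)] (.split 29 [(30, 543201), (45, 452310),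
  (46, 452301)] (.split 30 [] (.fc 3 543021) (.split 54 [(60, 541230)] (.split 27 [] (.fc 9
  543120) (.split 39 [] (.fc 20 453210) (.split 45 [] (.fc 10 451230) (.split 46 [] (.fc 9 351204)
  (.split 51 [] (.fc 9 543120) (.split 53 [] (.fc 10 415032) (.split 57 [] (.fc 14 452310) (.split
  58 [] (.fc 14 241503) (.split 59 [] (.fc 9 543120) (.split 60 [] (.fc 14 425013) (.split 62 []
  (.fc 9 534021) (.nc 13 543120)))))))))))) (.split 39 [(45, 541230)] (.split 27 [] (.fc 17
  543210) (.split 45 [] (.fc 17 453120) (.split 46 [] (.fc 8 543120) (.split 58 [] (.fc 10 543120)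
  (.split 62 [] (.fc 4 453210) (.split 51 [(53, 453120)] (.split 53 [] (.fc 22 354210) (.split 57
  [] (.fc 22 354210) (.split 61 [] (.fc 22 354210) (.nc 14 354210)))) (.nc 15 453210)))))))
  (.split 46 [] (.split 27 [] (.fc 8 451302) (.split 51 [] (.fc 9 534120) (.split 53 [] (.fc 11
  451302) (.split 55 [] (.fc 8 543120) (.split 57 [] (.fc 9 532140) (.split 58 [] (.fc 11 543120)
  (.split 59 [] (.fc 8 451302) (.split 61 [] (.fc 8 542130) (.split 62 [] (.fc 8 451203) (.nc 8
  543120)))))))))) (.split 51 [(57, 541230)] (.split 27 [] (.fc 17 532410) (.split 58 [] (.fc 10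
  543120) (.split 62 [] (.fc 7 543120) (.split 53 [] (.split 57 [] (.fc 22 315240) (.nc 15
  524130)) (.nc 16 543120))))) (.split 58 [] (.split 27 [] (.fc 8 431502) (.split 53 [] (.fc 15
  524130) (.split 55 [] (.fc 10 543120) (.split 61 [] (.fc 10 542130) (.split 62 [] (.fc 11
  543120) (.nc 9 543120)))))) (.split 27 [] (.split 53 [] (.fc 19 542310) (.split 62 [] (.fc 0
  543210) (.nc 67 542310))) (.split 53 [] (.split 62 [] (.fc 5 524130) (.nc 15 524130)) (.nc 4
  543120))))))))) (.split 53 [(54, 543201), (57, 452310), (58, 452301)] (.split 54 [] (.split 27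
  [] (.fc 11 415032) (.split 39 [] (.fc 8 354210) (.split 51 [] (.fc 11 415032) (.split 57 [] (.fc
  14 452310) (.split 58 [] (.fc 14 452301) (.split 59 [] (.fc 11 415032) (.split 60 [] (.fc 15
  215043) (.split 61 [] (.fc 10 415032) (.split 62 [] (.fc 10 415023) (.nc 9 415032))))))))))
  (.split 58 [] (.split 27 [] (.fc 10 431502) (.split 39 [] (.fc 10 345120) (.split 51 [] (.fc 9
  415320) (.split 57 [] (.fc 14 543210) (.split 60 [] (.fc 14 543210) (.split 61 [] (.fc 14
  543210) (.split 62 [] (.fc 14 452301) (.nc 11 543210)))))))) (.split 60 [] (.split 27 [] (.fc 15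
  542310) (.split 39 [] (.fc 10 354210) (.split 51 [] (.fc 14 534120) (.split 57 [] (.fc 14
  534120) (.split 59 [] (.fc 14 534120) (.split 62 [] (.fc 14 425031) (.nc 11 534120)))))))
  (.split 39 [] (.split 51 [] (.fc 17 345210) (.split 62 [] (.fc 4 354210) (.split 27 [] (.split
  57 [] (.fc 22 543210) (.split 61 [] (.fc 22 543210) (.nc 14 543210))) (.nc 15 354210)))) (.split
  27 [] (.split 62 [] (.fc 5 542310) (.split 51 [] (.split 57 [] (.fc 22 523410) (.split 61 []
  (.fc 22 523410) (.nc 14 523410))) (.nc 15 532410))) (.split 51 [] (.split 62 [] (.fc 7 415320)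
  (.nc 15 215430)) (.split 57 [] (.split 62 [] (.fc 13 543210) (.nc 15 354210)) (.nc 3
  543210)))))))) (.split 27 [(39, 452310)] (.split 39 [(51, 523410)] (.split 60 [] (.fc 18 543210)
  (.split 51 [] (.split 61 [] (.fc 21 543210) (.split 62 [] (.fc 21 543201) (.nc 108 543210)))
  (.split 61 [(62, 543201)] (.split 62 [] (.fc 1 543210) (.nc 104 543210)) (.nc 14 543210))))
  (.split 60 [] (.split 61 [(62, 543201)] (.split 55 [] (.fc 15 542310) (.split 62 [] (.fc 16
  542310) (.nc 12 542310))) (.nc 65 542310)) (.split 61 [(62, 543201)] (.split 55 [] (.split 62 []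
  (.fc 1 542310) (.nc 15 542310)) (.nc 1 542310)) (.nc 14 543210)))) (.split 51 [] (.split 60 []
  (.split 61 [] (.fc 12 543210) (.split 62 [] (.fc 12 543201) (.nc 10 543210))) (.nc 2 543210))
  (.nc 5 543210))))) (.split 27 [(29, 543120), (30, 543102)] (.split 29 [(30, 543201)] (.split 30
  [] (.fc 2 543210) (.split 58 [] (.fc 3 532410) (.split 60 [] (.fc 3 532140) (.split 39 [(57,
  521430)] (.split 57 [] (.fc 19 543210) (.split 62 [] (.fc 0 543210) (.nc 67 543210))) (.split 47
  [(55, 534210), (59, 532410), (61, 532140)] (.split 62 [] (.fc 0 543210) (.nc 67 543210)) (.nc 0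
  543210)))))) (.split 57 [(58, 543201)] (.split 58 [] (.split 39 [] (.fc 11 410532) (.split 47 []
  (.fc 8 532410) (.split 55 [] (.fc 8 523410) (.split 60 [] (.fc 11 532410) (.split 61 [] (.fc 8
  410532) (.split 62 [] (.fc 8 410523) (.nc 8 532410))))))) (.split 60 [] (.split 39 [] (.fc 15
  543210) (.split 47 [] (.fc 10 532410) (.split 55 [] (.fc 10 523410) (.split 62 [] (.fc 11
  532410) (.nc 9 532410))))) (.split 39 [] (.split 62 [] (.fc 5 543210) (.nc 15 543210)) (.nc 4
  532410)))) (.split 39 [] (.split 60 [] (.split 61 [(62, 543201)] (.split 59 [] (.fc 15 543210)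
  (.split 62 [] (.fc 16 543210) (.nc 12 543210))) (.nc 65 543210)) (.split 61 [(62, 543201)]
  (.split 59 [] (.split 62 [] (.fc 1 543210) (.nc 15 543210)) (.nc 1 543210)) (.nc 14 543210)))
  (.nc 7 543210)))) (.split 57 [(58, 543201), (60, 543021)] (.split 58 [(60, 543120)] (.split 39
  [(60, 210543)] (.split 60 [] (.fc 6 543210) (.split 61 [] (.fc 6 543210) (.split 62 [] (.fc 6
  543201) (.nc 61 543210)))) (.nc 6 543210)) (.nc 57 543210)) (.nc 57 543210)))) (.split 51 [(53,
  543120), (54, 543102), (57, 541320), (58, 541302), (60, 541032)] (.split 53 [(54, 543201), (57,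
  542310), (58, 542301)] (.split 58 [(60, 543120)] (.split 54 [(57, 542301)] (.split 57 [] (.fc 18
  105432) (.split 60 [] (.fc 18 105324) (.split 31 [(47, 453210)] (.split 47 [] (.fc 16 105423)
  (.split 61 [] (.fc 15 105423) (.nc 12 105423))) (.nc 65 105423)))) (.split 60 [] (.split 31 []
  (.fc 12 105432) (.split 47 [] (.fc 12 15432) (.nc 10 105432))) (.nc 5 105432))) (.split 54 []
  (.split 57 [] (.split 31 [(47, 453210)] (.split 47 [] (.fc 16 105432) (.split 62 [] (.fc 15
  105432) (.nc 12 105432))) (.nc 65 105432)) (.nc 7 105432)) (.nc 57 215430))) (.nc 5 534210))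
  (.nc 2 543210))) (.nc 2 543210)))))))))))))))))))))))

/-- The root imposes no condition: nothing is known to be a member, and all 63 nonempty subsets are
allowed. -/
theorem check_searchTree : searchTree.check [] (List.range' 1 63) = true := by
  decide +kernel

theorem mainTheorem1 : CollectionCovered (familiesOver 6) FC6 NC6 := by
  intro F hF
  refine covered_of_settled hF (SearchTree.settled check_searchTree
    supClosed_supClosure (by simp) fun s hs hne => ?_)
  obtain ⟨c, hc, rfl⟩ := exists_setOfCode (closure_subset_range hF hs)
  -- Code 0 is the empty set, so a nonempty set has a code from 1 to 63.
  refine ⟨c, List.mem_range'_1.2 ⟨Nat.pos_of_ne_zero ?_, by omega⟩, rfl⟩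
  rintro rfl
  simp [setOfCode] at hne
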